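/- Let $p$ be a prime and let $(\mathcal T,\mathcal G)$ be a tree of finite groups: $\mathcal T$ is a tree, each vertex $v$ and each edge $e$ carries a finite group $\mathcal G(v)$, $\mathcal G(e)$, and for each end $v$ of an edge $e$ there is a given monomorphism $\mathcal G(e)\to\mathcal G(v)$. Assume that $(\mathcal T,\mathcal G)$ is $p$-local: there is a vertex $v^*$ such that, for every vertex $v\neq v^*$, $p\nmid |\mathcal G(v)|/|\mathcal G(e)|$, where $e$ is the first edge on the path in $\mathcal T$ from $v$ to $v^*$. Let $G=\operatorname{colim}_{\mathcal T}\mathcal G$ be the completion, let $S\in\operatorname{Syl}_p(\mathcal G(v^*))$, regarded as a subgroup of $G$, and let $\mathcal F=\mathcal F_S(G)$ be the fusion system with objects the subgroups of $S$ and morphisms the homomorphisms given by conjugation by elements of $G$. Let $\tilde{\mathcal T}$ be the orbit graph of $(\mathcal T,\mathcal G)$: its vertices are the right cosets $\mathcal G(v)g$ ($v$ a vertex of $\mathcal T$, $g\in G$), and for every edge $e=(v,w)$ of $\mathcal T$ and every coset $\mathcal G(e)g$ there is one edge connecting $\mathcal G(v)g$ and $\mathcal G(w)g$; $G$ acts on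 it by right multiplication. For $P\le G$, let $\tilde{\mathcal T}^P$ be the subgraph of points fixed by $P$ and let $\tilde{\mathcal T}^P/C_G(P)$ be its quotient graph. Let $P\le S$ be $\mathcal F$-centric, that is, $C_S(Q)=Z(Q)$ for every $Q\le S$ that is isomorphic to $P$ in $\mathcal F$. Then the first homology $H_1(\tilde{\mathcal T}^P/C_G(P);\mathbb F_p)$ of this graph, viewed as a CW-complex, satisfies $$H_1\bigl(\tilde{\mathcal T}^P/C_G(P);\mathbb F_p\bigr)\;\cong\;\operatorname{Ab}\bigl(C_G(P)/Z(P)\bigr)\otimes_{\mathbb Z}\mathbb F_p$$ as $\mathbb F_p$-vector spaces, where $\operatorname{Ab}$ denotes abelianization. -/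

import Mathlib

open CategoryTheory

universe u w

/-! ### Trees of groups and their completion -/

/-- A graph of groups over a simple graph `T`: a functor to groups, with injective maps, from the
category whose objects are the vertices and the edges of `T` and whose only non-identity morphisms
are one morphism `e ⟶ v` for each edge `e` and each end `v` of `e`. -/
structure GraphOfGroups {V : Type u} (T : SimpleGraph V) where
  obj : V ⊕ T.edgeSet → Type w
  [group : ∀ X, Group (obj X)]
  map : ∀ (e : T.edgeSet) (v : V), v ∈ e.1 → obj (Sum.inr e) →* obj (Sum.inl v)
  map_injective : ∀ (e : T.edgeSet) (v : V) (h : v ∈ e.1), Function.Injective (map e v h)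

attribute [instance] GraphOfGroups.group

namespace GraphOfGroups

variable {V : Type u} {T : SimpleGraph V} (𝒢 : GraphOfGroups.{u, w} T)

/-- The relators `b · (f b)⁻¹` of the colimit, `f` running over the maps of the graph of groups. -/
def relators : Set (Monoid.CoprodI 𝒢.obj) :=
  {r | ∃ (e : T.edgeSet) (v : V) (h : v ∈ e.1) (b : 𝒢.obj (Sum.inr e)),
    r = Monoid.CoprodI.of b * (Monoid.CoprodI.of (𝒢.map e v h b))⁻¹}

/-- The completion: the colimit of the graph of groups in the category of groups, as the
free product of all the groups modulo the relations identifying each `b` with its images. -/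
def Completion : Type (max u w) :=
  Monoid.CoprodI 𝒢.obj ⧸ Subgroup.normalClosure 𝒢.relators

instance : Group 𝒢.Completion :=
  inferInstanceAs (Group (Monoid.CoprodI 𝒢.obj ⧸ Subgroup.normalClosure 𝒢.relators))

/-- The canonical homomorphism from a vertex or edge group to the completion. -/
def ι (X : V ⊕ T.edgeSet) : 𝒢.obj X →* 𝒢.Completion :=
  (QuotientGroup.mk' (Subgroup.normalClosure 𝒢.relators)).comp Monoid.CoprodI.of

theorem ι_map (e : T.edgeSet) (v : V) (h : v ∈ e.1) (b : 𝒢.obj (Sum.inr e)) :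
    𝒢.ι (Sum.inl v) (𝒢.map e v h b) = 𝒢.ι (Sum.inr e) b := by
  symm
  apply QuotientGroup.eq_iff_div_mem.mpr
  rw [div_eq_mul_inv]
  exact Subgroup.subset_normalClosure ⟨e, v, h, b, rfl⟩

/-- The image of a vertex or edge group in the completion. -/
def subgroup (X : V ⊕ T.edgeSet) : Subgroup 𝒢.Completion := (𝒢.ι X).range

theorem subgroup_le (e : T.edgeSet) (v : V) (h : v ∈ e.1) :
    𝒢.subgroup (Sum.inr e) ≤ 𝒢.subgroup (Sum.inl v) := by
  rintro _ ⟨b, rfl⟩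
  exact ⟨𝒢.map e v h b, 𝒢.ι_map e v h b⟩

/-- The graph of groups is `p`-local with centre `v₀`: for every vertex `v ≠ v₀`, the index
in `𝒢 v` of the image of `𝒢 e` is prime to `p`, where `e = {v, w}` is the first edge on the path
from `v` to `v₀`. -/
def IsPLocal (p : ℕ) (v₀ : V) : Prop :=
  ∀ (v w : V) (h : T.Adj v w), (∃ q : T.Walk w v₀, (SimpleGraph.Walk.cons h q).IsPath) →
    ¬ p ∣ (𝒢.map ⟨s(v, w), h⟩ v (Sym2.mem_mk_left v w)).range.index

end GraphOfGroups

/-! ### Graphs (with multiple edges and loops allowed), group actions, homology -/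

/-- A graph, possibly with loops and multiple edges, seen as a one-dimensional CW complex in which
every edge comes with an orientation. -/
structure OrientedGraph where
  Vert : Type u
  Edge : Type w
  src : Edge → Vert
  tgt : Edge → Vert

namespace OrientedGraph

variable (R : Type*) [CommRing R] (Γ : OrientedGraph.{u, w})

/-- The cellular boundary map `C₁(Γ; R) → C₀(Γ; R)`. -/
noncomputable def boundary : (Γ.Edge →₀ R) →ₗ[R] (Γ.Vert →₀ R) :=
  Finsupp.linearCombination R fun e => Finsupp.single (Γ.tgt e) 1 - Finsupp.single (Γ.src e) 1

/-- First cellular homology `H₁(Γ; R)`. There are no two-cells, so this is the module of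
one-cycles. -/
noncomputable abbrev H1 : Type _ := LinearMap.ker (Γ.boundary R)

end OrientedGraph

/-- A graph with a right action of the group `G` that preserves the orientation of the edges
(in particular, no edge is inverted). -/
structure RightGraph (G : Type*) [Group G] extends OrientedGraph.{u, w} where
  actV : Vert → G → Vert
  actE : Edge → G → Edge
  actV_one : ∀ x, actV x 1 = x
  actE_one : ∀ x, actE x 1 = x
  actV_mul : ∀ x g h, actV x (g * h) = actV (actV x g) h
  actE_mul : ∀ x g h, actE x (g * h) = actE (actE x g) h
  src_act : ∀ x g, src (actE x g) = actV (src x) g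
  tgt_act : ∀ x g, tgt (actE x g) = actV (tgt x) g

namespace RightGraph

variable {G : Type*} [Group G] (Γ : RightGraph.{u, w} G) (P : Subgroup G)

/-- The subgraph `Γ^P` of points fixed by `P`. -/
def fixed : OrientedGraph.{u, w} where
  Vert := {x : Γ.Vert // ∀ g ∈ P, Γ.actV x g = x}
  Edge := {x : Γ.Edge // ∀ g ∈ P, Γ.actE x g = x}
  src x := ⟨Γ.src x.1, fun g hg => by rw [← Γ.src_act, x.2 g hg]⟩
  tgt x := ⟨Γ.tgt x.1, fun g hg => by rw [← Γ.tgt_act, x.2 g hg]⟩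

/-- Two vertices of `Γ^P` are equivalent if they lie in one `C_G(P)`-orbit. -/
def vertSetoid : Setoid (Γ.fixed P).Vert where
  r x y := ∃ c ∈ Subgroup.centralizer (P : Set G), Γ.actV x.1 c = y.1
  iseqv :=
    { refl := fun x => ⟨1, one_mem _, Γ.actV_one _⟩
      symm := by
        rintro x y ⟨c, hc, h⟩
        exact ⟨c⁻¹, inv_mem hc, by rw [← h, ← Γ.actV_mul, mul_inv_cancel, Γ.actV_one]⟩
      trans := by
        rintro x y z ⟨c, hc, h⟩ ⟨d, hd, k⟩
        exact ⟨c * d, mul_mem hc hd, by rw [Γ.actV_mul, h, k]⟩ }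

/-- Two edges of `Γ^P` are equivalent if they lie in one `C_G(P)`-orbit. -/
def edgeSetoid : Setoid (Γ.fixed P).Edge where
  r x y := ∃ c ∈ Subgroup.centralizer (P : Set G), Γ.actE x.1 c = y.1
  iseqv :=
    { refl := fun x => ⟨1, one_mem _, Γ.actE_one _⟩
      symm := by
        rintro x y ⟨c, hc, h⟩
        exact ⟨c⁻¹, inv_mem hc, by rw [← h, ← Γ.actE_mul, mul_inv_cancel, Γ.actE_one]⟩
      trans := by
        rintro x y z ⟨c, hc, h⟩ ⟨d, hd, k⟩
        exact ⟨c * d, mul_mem hc hd, by rw [Γ.actE_mul, h, k]⟩ }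

/-- The quotient graph `Γ^P / C_G(P)`. -/
def fixedQuotient : OrientedGraph.{u, w} where
  Vert := Quotient (Γ.vertSetoid P)
  Edge := Quotient (Γ.edgeSetoid P)
  src := Quotient.map (sa := Γ.edgeSetoid P) (sb := Γ.vertSetoid P) (Γ.fixed P).src (by
    rintro x y ⟨c, hc, h⟩
    exact ⟨c, hc, (Γ.src_act x.1 c).symm.trans (congrArg Γ.src h)⟩)
  tgt := Quotient.map (sa := Γ.edgeSetoid P) (sb := Γ.vertSetoid P) (Γ.fixed P).tgt (by
    rintro x y ⟨c, hc, h⟩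
    exact ⟨c, hc, (Γ.tgt_act x.1 c).symm.trans (congrArg Γ.tgt h)⟩)

end RightGraph

/-! ### Right cosets and the orbit graph -/

/-- The set `H \ G` of right cosets `H g`. -/
abbrev RightCosets {G : Type*} [Group G] (H : Subgroup G) : Type _ :=
  Quotient (QuotientGroup.rightRel H)

namespace RightCosets

variable {G : Type*} [Group G] {H K : Subgroup G}

/-- The right action `(H x) · g = H (x g)`. -/
def act (x : RightCosets H) (g : G) : RightCosets H :=
  Quotient.map' (s₁ := QuotientGroup.rightRel H) (s₂ := QuotientGroup.rightRel H)
    (fun y => y * g) (fun a b h => by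
      rw [QuotientGroup.rightRel_apply] at h ⊢
      simpa [mul_assoc] using h) x

/-- The map `H g ↦ K g` for `H ≤ K`. -/
def proj (h : H ≤ K) (x : RightCosets H) : RightCosets K :=
  Quotient.map' (s₁ := QuotientGroup.rightRel H) (s₂ := QuotientGroup.rightRel K)
    id (fun a b hab => by
      rw [QuotientGroup.rightRel_apply] at hab ⊢
      exact h hab) x

theorem act_one (x : RightCosets H) : act x 1 = x := by
  induction x using Quotient.inductionOn' with
  | h y => exact congrArg _ (mul_one y)

theorem act_mul (x : RightCosets H) (g k : G) : act x (g * k) = act (act x g) k := by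
  induction x using Quotient.inductionOn' with
  | h y => exact congrArg _ (mul_assoc y g k).symm

theorem proj_act (h : H ≤ K) (x : RightCosets H) (g : G) :
    proj h (act x g) = act (proj h x) g := by
  induction x using Quotient.inductionOn' with
  | h y => rfl

end RightCosets

namespace GraphOfGroups

variable {V : Type u} {T : SimpleGraph V} (𝒢 : GraphOfGroups.{u, w} T)

/-- The orbit graph: its vertices are the cosets `𝒢(v) g`, its edges the cosets `𝒢(e) g`, and for
an edge `e = {v, v'}` of `T` the edge `𝒢(e) g` connects `𝒢(v) g` and `𝒢(v') g`. The completion acts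
by right multiplication. Edges are oriented along an arbitrary orientation of the edges of `T`. -/
noncomputable def orbitGraph : RightGraph.{max u w, max u w} 𝒢.Completion where
  Vert := Σ v : V, RightCosets (𝒢.subgroup (Sum.inl v))
  Edge := Σ e : T.edgeSet, RightCosets (𝒢.subgroup (Sum.inr e))
  src x := ⟨(Quot.out x.1.1).1,
    RightCosets.proj (𝒢.subgroup_le x.1 _ (Sym2.out_fst_mem x.1.1)) x.2⟩
  tgt x := ⟨(Quot.out x.1.1).2,
    RightCosets.proj (𝒢.subgroup_le x.1 _ (Sym2.out_snd_mem x.1.1)) x.2⟩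
  actV x g := ⟨x.1, RightCosets.act x.2 g⟩
  actE x g := ⟨x.1, RightCosets.act x.2 g⟩
  actV_one x := by rw [RightCosets.act_one]
  actE_one x := by rw [RightCosets.act_one]
  actV_mul x g h := by rw [RightCosets.act_mul]
  actE_mul x g h := by rw [RightCosets.act_mul]
  src_act x g := by simp only [RightCosets.proj_act]
  tgt_act x g := by simp only [RightCosets.proj_act]

/-- `H₁(T̃^P / C_G(P); 𝔽_p)`, where `T̃` is the orbit graph and `G` the completion. -/
noncomputable abbrev CGp (p : ℕ) (P : Subgroup 𝒢.Completion) : Type _ :=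
  (𝒢.orbitGraph.fixedQuotient P).H1 (ZMod p)

end GraphOfGroups

/-! ### Fusion systems -/

/-- The objects of the fusion system `F_S(G)`: the subgroups of `S`. -/
structure FusionSystem {G : Type*} [Group G] (S : Subgroup G) where
  carrier : Subgroup G
  le : carrier ≤ S

namespace FusionSystem

variable {G : Type*} [Group G] {S : Subgroup G}

/-- The category `F_S(G)`: morphisms are the homomorphisms given by conjugation by an element
of `G`. -/
instance : Category (FusionSystem S) where
  Hom P Q := {φ : P.carrier →* Q.carrier // ∃ g : G, ∀ x, (φ x : G) = g⁻¹ * x * g}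
  id P := ⟨MonoidHom.id _, 1, fun x => by simp⟩
  comp φ ψ := ⟨ψ.1.comp φ.1, by
    obtain ⟨g, hg⟩ := φ.2
    obtain ⟨h, hh⟩ := ψ.2
    exact ⟨g * h, fun x => by simp [hg, hh, mul_assoc]⟩⟩

/-- `P ≤ S` is `F`-centric, for `F = F_S(G)`, if `C_S(Q) = Z(Q)` for every `Q ≤ S` that is
isomorphic to `P` in `F`. -/
def IsCentric (P : FusionSystem S) : Prop :=
  ∀ Q : FusionSystem S, Nonempty (P ≅ Q) →
    Subgroup.centralizer (Q.carrier : Set G) ⊓ S =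
      (Subgroup.center Q.carrier).map Q.carrier.subtype

end FusionSystem

/-- The centre `Z(P)`, as a subgroup of the centralizer `C_G(P)`. -/
def centerInCentralizer {G : Type*} [Group G] (P : Subgroup G) :
    Subgroup (Subgroup.centralizer (P : Set G)) :=
  ((Subgroup.center P).map P.subtype).subgroupOf (Subgroup.centralizer (P : Set G))

instance centerInCentralizer_normal {G : Type*} [Group G] (P : Subgroup G) :
    (centerInCentralizer P).Normal where
  conj_mem n hn g := by
    have hP : (n : G) ∈ P := by
      obtain ⟨z, -, hz⟩ := Subgroup.mem_subgroupOf.mp hn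
      rw [← hz]
      exact z.2
    have h : g * n * g⁻¹ = n := by
      ext
      have := Subgroup.mem_centralizer_iff.mp g.2 n hP
      simp [← this]
    rwa [h]

/-! Write C = C_G(P) and X for the fixed subgraph. The orbit graph is a tree, hence so is X, and C
acts on X without inverting edges. A path in X from a base vertex x₀ to x₀c projects to a cycle in
X/C. This gives a homomorphism from C to H₁(X/C), whose image spans the homology and which kills
every c fixing x₀, in particular Z(P). Conversely, a homomorphism from C to an R-module that
vanishes on all vertex stabilizers factors through H₁(X/C; R). So it suffices that every vertex
stabilizer dies in 𝔽_p ⊗ Ab(C/Z(P)); the two maps are then mutually inverse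
(`nonempty_H1_fixedQuotient_equiv`).

The stabilizers die because each of their elements has a power of exponent prime to p in Z(P)
(`exists_pow_mem_centerInCentralizer`). If c fixes 𝒢(v)g, some c^m with p ∤ m has p-power order and
generates with P a p-group fixing 𝒢(v)g. By p-locality this p-group is conjugate into S
(`IsPLocal.exists_conj_mem`), and centricity puts c^m into P.

That the orbit graph is a tree is proved cohomologically, without normal forms: every one-cochain is
a coboundary (`exists_coboundary`), by the universal property of the completion. Indicator cochains
of edges then give acyclicity, uniqueness of an edge with given source and target, and injectivity
of the boundary map; exactness passes to fixed subgraphs. -/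

/-! ### Potentials on trees -/

/-- On a tree, every antisymmetric function on pairs of adjacent vertices is a coboundary. -/
theorem SimpleGraph.IsTree.exists_potential {V M : Type*} [AddCommGroup M] {T : SimpleGraph V}
    (hT : T.IsTree) (F : V → V → M) (hF : ∀ v w, T.Adj v w → F w v = -F v w) :
    ∃ m : V → M, ∀ v w, T.Adj v w → m w - m v = F v w := by
  classical
  obtain ⟨v₀⟩ := hT.connected.nonempty
  choose q hq hu using hT.existsUnique_path v₀
  let s : ∀ {a b : V}, T.Walk a b → M := fun r => (r.darts.map fun d => F d.fst d.snd).sum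
  have key : ∀ v w (h : T.Adj v w), w ∉ (q v).support → s (q w) = s (q v) + F v w := by
    intro v w h hw
    have : (q v).concat h = q w := hu w _ ((hq v).concat hw h)
    simp only [s, ← this, SimpleGraph.Walk.darts_concat]
    simp
  refine ⟨fun v => s (q v), fun v w h => ?_⟩
  -- Of two adjacent vertices, one lies off the chosen path to the other: otherwise each path would
  -- be a proper initial segment of the other. So `key` applies in one direction.
  by_cases hw : w ∈ (q v).support
  · have hv : v ∉ (q w).support := by
      intro hv
      have h1 : (q v).takeUntil w hw = q w := hu w _ ((hq v).takeUntil hw)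
      have h2 : (q w).takeUntil v hv = q v := hu v _ ((hq w).takeUntil hv)
      have l1 := (q v).length_takeUntil_lt_length hw h.ne'
      have l2 := (q w).length_takeUntil_lt_length hv h.ne
      rw [h1] at l1
      rw [h2] at l2
      omega
    simp only [key w v h.symm hv, hF v w h]
    abel
  · simp only [key v w h hw]
    abel

/-- On a tree, every function on oriented edges is a coboundary. -/
theorem SimpleGraph.IsTree.exists_potential_edgeSet {V M : Type*} [AddCommGroup M]
    {T : SimpleGraph V} (hT : T.IsTree) (f : T.edgeSet → M) :
    ∃ m : V → M, ∀ e : T.edgeSet, m (Quot.out e.1).2 - m (Quot.out e.1).1 = f e := by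
  classical
  have hout : ∀ e : Sym2 V, s((Quot.out e).1, (Quot.out e).2) = e := fun e => Quot.out_eq e
  obtain ⟨m, hm⟩ := hT.exists_potential (fun v w => if h : T.Adj v w then
    if (Quot.out s(v, w)).1 = v then f ⟨s(v, w), h⟩ else -f ⟨s(v, w), h⟩ else 0) (by
      intro v w h
      have e : s(w, v) = s(v, w) := Sym2.eq_swap
      have hne := h.ne
      have hc : (Quot.out s(v, w)).1 = v ∨ (Quot.out s(v, w)).1 = w := by
        have := Sym2.out_fst_mem s(v, w)
        rwa [Sym2.mem_iff] at this
      simp only [h, h.symm, dif_pos, e]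
      rcases hc with hc | hc <;> simp [hc, hne, hne.symm])
  refine ⟨m, fun e => ?_⟩
  have he : T.Adj (Quot.out e.1).1 (Quot.out e.1).2 := by
    rw [← SimpleGraph.mem_edgeSet, hout]
    exact e.2
  have := hm _ _ he
  rw [this, dif_pos he]
  simp only [hout, if_true, Subtype.coe_eta]

namespace GraphOfGroups

variable {V : Type u} {T : SimpleGraph V} (𝒢 : GraphOfGroups.{u, w} T)

/-! ### The universal property of the completion -/

/-- Compatible homomorphisms on the vertex groups extend to the completion. -/
theorem exists_lift {K : Type*} [Group K] (θ : ∀ v, 𝒢.obj (Sum.inl v) →* K)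
    (hθ : ∀ (e : T.edgeSet) (v w : V) (hv : v ∈ e.1) (hw : w ∈ e.1) (b : 𝒢.obj (Sum.inr e)),
      θ v (𝒢.map e v hv b) = θ w (𝒢.map e w hw b)) :
    ∃ Θ : 𝒢.Completion →* K, ∀ v a, Θ (𝒢.ι (Sum.inl v) a) = θ v a := by
  let f : ∀ X, 𝒢.obj X →* K := fun X => match X with
    | Sum.inl v => θ v
    | Sum.inr e => (θ _).comp (𝒢.map e _ (Sym2.out_fst_mem e.1))
  have hle : Subgroup.normalClosure 𝒢.relators ≤ (Monoid.CoprodI.lift f).ker := by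
    apply Subgroup.normalClosure_le_normal
    rintro _ ⟨e, v, h, b, rfl⟩
    simp only [SetLike.mem_coe, MonoidHom.mem_ker, map_mul, map_inv, Monoid.CoprodI.lift_of]
    rw [mul_inv_eq_one]
    exact hθ e _ _ _ _ b
  refine ⟨QuotientGroup.lift _ (Monoid.CoprodI.lift f) hle, fun v a => ?_⟩
  exact Monoid.CoprodI.lift_of (fi := f) (i := Sum.inl v) a

variable {𝒢} in
/-- The completion is generated by the vertex groups. -/
theorem Completion.induction {motive : 𝒢.Completion → Prop} (one : motive 1)
    (of : ∀ v a, motive (𝒢.ι (Sum.inl v) a)) (mul : ∀ a b, motive a → motive b → motive (a * b))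
    (g : 𝒢.Completion) : motive g := by
  obtain ⟨x, rfl⟩ := QuotientGroup.mk'_surjective (Subgroup.normalClosure 𝒢.relators) g
  induction x using Monoid.CoprodI.induction_on with
  | one => exact one
  | of X a =>
    cases X with
    | inl v => exact of v a
    | inr e =>
      have := of _ (𝒢.map e _ (Sym2.out_fst_mem e.1) a)
      rw [𝒢.ι_map] at this
      exact this
  | mul x y hx hy =>
    rw [map_mul]
    exact mul _ _ hx hy

/-- Left multiplication on `G × R`, twisted by the coboundary of `n : G → R`. -/
def twist {G R : Type*} [Group G] [AddCommGroup R] (n : G → R) : G →* Equiv.Perm (G × R) where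
  toFun a :=
    { toFun := fun x => (a * x.1, x.2 - n x.1 + n (a * x.1))
      invFun := fun x => (a⁻¹ * x.1, x.2 - n x.1 + n (a⁻¹ * x.1))
      left_inv := fun x => by ext <;> simp
      right_inv := fun x => by ext <;> simp }
  map_one' := by ext <;> simp
  map_mul' a b := by ext <;> simp [mul_assoc]

/-- Every one-cochain on the orbit graph of a tree of groups is a coboundary. -/
theorem exists_coboundary (hT : T.IsTree) {R : Type*} [AddCommGroup R]
    (f : 𝒢.orbitGraph.Edge → R) :
    ∃ h : 𝒢.orbitGraph.Vert → R,
      ∀ e, h (𝒢.orbitGraph.tgt e) - h (𝒢.orbitGraph.src e) = f e := by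
  -- The potential takes values in functions G → R: one works over `T`, treating all translates g at
  -- once. What remains is to correct the m v so that they descend to cosets.
  obtain ⟨m, hm⟩ := hT.exists_potential_edgeSet
    (fun (e : T.edgeSet) (g : 𝒢.Completion) =>
      f ⟨e, (Quotient.mk _ g : RightCosets (𝒢.subgroup (Sum.inr e)))⟩)
  -- For the two ends of e, m v and m w differ up to sign by g ↦ f(𝒢(e)g), which is invariant under
  -- left translation by 𝒢(e). Hence the twisted actions of 𝒢(v) and 𝒢(w) agree on 𝒢(e).
  have hinv : ∀ (e : T.edgeSet) (v w : V) (hv : v ∈ e.1) (hw : w ∈ e.1) (b : 𝒢.obj (Sum.inr e))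
      (g : 𝒢.Completion), m v (𝒢.ι (Sum.inr e) b * g) - m v g
        = m w (𝒢.ι (Sum.inr e) b * g) - m w g := by
    have main : ∀ (e : T.edgeSet) (b : 𝒢.obj (Sum.inr e)) (g : 𝒢.Completion),
        m (Quot.out e.1).1 (𝒢.ι (Sum.inr e) b * g) - m (Quot.out e.1).1 g
        = m (Quot.out e.1).2 (𝒢.ι (Sum.inr e) b * g) - m (Quot.out e.1).2 g := by
      intro e b g
      have h1 := congrFun (hm e) (𝒢.ι (Sum.inr e) b * g)
      have h2 := congrFun (hm e) g
      have h3 : (Quotient.mk _ (𝒢.ι (Sum.inr e) b * g) : RightCosets (𝒢.subgroup (Sum.inr e)))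
          = Quotient.mk _ g := by
        apply Quotient.sound
        change QuotientGroup.rightRel _ _ _
        rw [QuotientGroup.rightRel_apply]
        have hb : 𝒢.ι (Sum.inr e) b ∈ 𝒢.subgroup (Sum.inr e) := ⟨b, rfl⟩
        simpa using inv_mem hb
      simp only [Pi.sub_apply] at h1 h2
      rw [h3, ← h2, sub_eq_sub_iff_add_eq_add] at h1
      rw [sub_eq_sub_iff_add_eq_add, add_comm, ← h1, add_comm]
    have hmem : ∀ (e : T.edgeSet) v, v ∈ e.1 → v = (Quot.out e.1).1 ∨ v = (Quot.out e.1).2 := by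
      intro e v hv
      have h : s((Quot.out e.1).1, (Quot.out e.1).2) = e.1 := Quot.out_eq e.1
      rwa [← h, Sym2.mem_iff] at hv
    intro e v w hv hw b g
    rcases hmem e v hv with rfl | rfl <;> rcases hmem e w hw with rfl | rfl <;>
      first | rfl | exact main e b g | exact (main e b g).symm
  -- The twisted actions glue to an action of G on G × R. Following the point (1, 0) gives one
  -- function n on G with the same increments as m v under left translation by 𝒢(v), for every v.
  obtain ⟨Θ, hΘ⟩ := 𝒢.exists_lift (fun v => (twist (m v)).comp (𝒢.ι (Sum.inl v))) (by
    intro e v w hv hw b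
    ext x
    · simp [twist, 𝒢.ι_map]
    · have := hinv e v w hv hw b x.1
      simp only [twist, MonoidHom.comp_apply, 𝒢.ι_map, MonoidHom.coe_mk, OneHom.coe_mk,
        Equiv.coe_fn_mk]
      rw [sub_add_eq_add_sub, add_sub_assoc, this, sub_add_eq_add_sub, add_sub_assoc])
  have hfst : ∀ g x, (Θ g x).1 = g * x.1 := by
    intro g
    induction g using Completion.induction with
    | one => simp
    | of v a => intro x; rw [hΘ]; rfl
    | mul a b ha hb => intro x; rw [map_mul, Equiv.Perm.mul_apply, ha, hb, mul_assoc]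
  let n : 𝒢.Completion → R := fun g => (Θ g (1, 0)).2
  have hn : ∀ v a g, n (𝒢.ι (Sum.inl v) a * g)
      = n g - m v g + m v (𝒢.ι (Sum.inl v) a * g) := by
    intro v a g
    have h0 : Θ g (1, 0) = (g, n g) := Prod.ext (by simp [hfst]) rfl
    change (Θ _ _).2 = _
    rw [map_mul, Equiv.Perm.mul_apply, hΘ, h0]
    rfl
  -- Thus m v - n is constant on the cosets of 𝒢(v), and n cancels in the difference along an edge.
  refine ⟨fun x => Quotient.liftOn x.2 (fun g => m x.1 g - n g) ?_, ?_⟩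
  · intro a b hab
    change QuotientGroup.rightRel _ _ _ at hab
    rw [QuotientGroup.rightRel_apply] at hab
    obtain ⟨c, hc⟩ := hab
    have hb : b = 𝒢.ι (Sum.inl x.1) c * a := by rw [hc]; simp
    change m x.1 a - n a = m x.1 b - n b
    rw [hb, hn]
    abel
  · rintro ⟨e, y⟩
    induction y using Quotient.inductionOn with
    | h g =>
      have := congrFun (hm e) g
      simp only [Pi.sub_apply] at this
      rw [← this]
      change (m _ g - n g) - (m _ g - n g) = _
      abel

end GraphOfGroups

/-! ### Acyclicity and fixed subgraphs -/

namespace OrientedGraph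

variable (Γ : OrientedGraph.{u, w})

/-- The simple graph underlying an oriented graph. -/
def adjGraph : SimpleGraph Γ.Vert :=
  SimpleGraph.fromRel fun a b => ∃ e, Γ.src e = a ∧ Γ.tgt e = b

theorem adjGraph_adj {a b : Γ.Vert} : Γ.adjGraph.Adj a b ↔
    a ≠ b ∧ ((∃ e, Γ.src e = a ∧ Γ.tgt e = b) ∨ ∃ e, Γ.src e = b ∧ Γ.tgt e = a) :=
  SimpleGraph.fromRel_adj _ _ _

theorem reachable_src_tgt (e : Γ.Edge) : Γ.adjGraph.Reachable (Γ.src e) (Γ.tgt e) := by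
  by_cases h : Γ.src e = Γ.tgt e
  · rw [h]
  · exact (Γ.adjGraph_adj.mpr ⟨h, Or.inl ⟨e, rfl, rfl⟩⟩).reachable

/-- Every one-cochain with values in `R` is a coboundary. -/
def CochainsExact (R : Type*) [AddCommGroup R] : Prop :=
  ∀ f : Γ.Edge → R, ∃ h : Γ.Vert → R, ∀ e, h (Γ.tgt e) - h (Γ.src e) = f e

variable {Γ} {R : Type*} [CommRing R]

@[simp]
theorem boundary_single (e : Γ.Edge) (r : R) : Γ.boundary R (Finsupp.single e r) =
    r • (Finsupp.single (Γ.tgt e) 1 - Finsupp.single (Γ.src e) 1) := by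
  simp [boundary]

namespace CochainsExact

/-- A potential for the indicator of e would have to jump by both 1 and 0 between the same two
vertices. -/
theorem eq_of_src_tgt (hΓ : Γ.CochainsExact R) [Nontrivial R] {e e' : Γ.Edge} (hs : Γ.src e = Γ.src e')
    (ht : Γ.tgt e = Γ.tgt e') : e = e' := by
  classical
  obtain ⟨h, hh⟩ := hΓ (Pi.single e 1)
  by_contra hne
  have h1 := hh e
  have h2 := hh e'
  rw [hs, ht, h2] at h1
  simp [Ne.symm hne] at h1

/-- A potential for the indicator of e is constant along walks avoiding e but jumps by 1 across e,
so e is a bridge. -/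
theorem isAcyclic (hΓ : Γ.CochainsExact R) [Nontrivial R] : Γ.adjGraph.IsAcyclic := by
  classical
  have main : ∀ e, Γ.adjGraph.IsBridge s(Γ.src e, Γ.tgt e) := by
    intro e
    rw [SimpleGraph.isBridge_iff]
    obtain ⟨h, hh⟩ := hΓ (Pi.single e 1)
    have hc : ∀ a b, (Γ.adjGraph.deleteEdges {s(Γ.src e, Γ.tgt e)}).Reachable a b → h a = h b := by
      rintro a b ⟨q⟩
      induction q with
      | nil => rfl
      | @cons a b c hab _ ih =>
        rw [← ih]
        rw [SimpleGraph.deleteEdges_adj, adjGraph_adj] at hab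
        obtain ⟨⟨-, ⟨e', rfl, rfl⟩ | ⟨e', rfl, rfl⟩⟩, hne⟩ := hab
        · have h1 := hh e'
          rw [Pi.single_eq_of_ne (by rintro rfl; exact hne rfl), sub_eq_zero] at h1
          exact h1.symm
        · have h1 := hh e'
          rw [Pi.single_eq_of_ne (by rintro rfl; exact hne Sym2.eq_swap), sub_eq_zero] at h1
          exact h1
    intro hr
    have h1 := hh e
    rw [hc _ _ hr] at h1
    simp at h1
  rw [SimpleGraph.isAcyclic_iff_forall_adj_isBridge]
  intro a b hab
  rw [adjGraph_adj] at hab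
  obtain ⟨-, ⟨e, rfl, rfl⟩ | ⟨e, rfl, rfl⟩⟩ := hab
  · exact main e
  · rw [Sym2.eq_swap]
    exact main e

/-- Stokes' formula: pairing a chain with a coboundary is pairing its boundary with the potential.
-/
theorem boundary_pairing {M : Type*} [AddCommGroup M] [Module R M] {h : Γ.Vert → M}
    {f : Γ.Edge → M}
    (hh : ∀ e, h (Γ.tgt e) - h (Γ.src e) = f e) (y : Γ.Edge →₀ R) :
    Finsupp.linearCombination R h (Γ.boundary R y) = Finsupp.linearCombination R f y := by
  induction y using Finsupp.induction_linear with
  | zero => simp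
  | add a b ha hb => simp [ha, hb]
  | single e r => simp [← hh, smul_sub]

/-- The coefficient of a chain at e is its pairing with the indicator of e, a coboundary; by Stokes
it depends only on the boundary. -/
theorem boundary_injective (hΓ : Γ.CochainsExact R) : Function.Injective (Γ.boundary R) := by
  classical
  rw [← LinearMap.ker_eq_bot, LinearMap.ker_eq_bot']
  intro y hy
  ext e
  obtain ⟨h, hh⟩ := hΓ (Pi.single e 1)
  have := boundary_pairing hh y
  rw [hy, map_zero, Finsupp.linearCombination_apply, Finsupp.sum_eq_single e] at this
  · simpa using this.symm
  · intro e' _ hne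
    simp [hne]
  · simp

end CochainsExact

end OrientedGraph

namespace RightGraph

variable {G : Type*} [Group G] {Γ : RightGraph.{u, w} G} {R : Type*} [CommRing R]

/-- Extend a cochain by zero off the fixed edges and restrict a potential of the extension. -/
theorem fixed_cochainsExact (hΓ : Γ.CochainsExact R) (P : Subgroup G) :
    (Γ.fixed P).CochainsExact R := by
  classical
  intro f
  obtain ⟨h, hh⟩ := hΓ (fun e => if he : ∀ g ∈ P, Γ.actE e g = e then f ⟨e, he⟩ else 0)
  refine ⟨fun x => h x.1, fun e => ?_⟩
  exact (hh e.1).trans (dif_pos e.2)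

theorem actV_injective (g : G) : Function.Injective fun x => Γ.actV x g := by
  intro a b h
  change Γ.actV a g = Γ.actV b g at h
  rw [← Γ.actV_one a, ← mul_inv_cancel g, Γ.actV_mul, h, ← Γ.actV_mul, mul_inv_cancel,
    Γ.actV_one]

variable (Γ) in
/-- Translation by a group element, as an endomorphism of the underlying simple graph. -/
def adjHom (g : G) : Γ.adjGraph →g Γ.adjGraph where
  toFun x := Γ.actV x g
  map_rel' := by
    intro a b hab
    rw [OrientedGraph.adjGraph_adj] at hab ⊢
    refine ⟨fun h => hab.1 (actV_injective g h), ?_⟩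
    rcases hab.2 with ⟨e, rfl, rfl⟩ | ⟨e, rfl, rfl⟩
    · exact Or.inl ⟨Γ.actE e g, Γ.src_act e g, Γ.tgt_act e g⟩
    · exact Or.inr ⟨Γ.actE e g, Γ.src_act e g, Γ.tgt_act e g⟩

/-- The element g carries the path to a path with the same ends, which in a forest is the same path,
traversed in the same order. -/
theorem map_support_of_isPath (hΓ : Γ.adjGraph.IsAcyclic) {x y : Γ.Vert}
    (q : Γ.adjGraph.Walk x y) (hq : q.IsPath) {g : G} (hx : Γ.actV x g = x)
    (hy : Γ.actV y g = y) {z : Γ.Vert} (hz : z ∈ q.support) : Γ.actV z g = z := by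
  let q' : Γ.adjGraph.Walk x y := (q.map (Γ.adjHom g)).copy hx hy
  have hq' : q'.IsPath := by
    exact (SimpleGraph.Walk.isPath_copy _ hx hy).mpr (hq.map (actV_injective g))
  have heq : q' = q := congrArg Subtype.val
    ((hΓ.subsingleton_path x y).elim (⟨q', hq'⟩ : Γ.adjGraph.Path x y) ⟨q, hq⟩)
  have hs : q.support.map (Γ.adjHom g) = q.support.map id := by
    rw [List.map_id, ← SimpleGraph.Walk.support_map, ← congrArg SimpleGraph.Walk.support heq]
    exact (SimpleGraph.Walk.support_copy _ hx hy).symm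
  exact List.map_inj_left.mp hs z hz

variable {P : Subgroup G}

/-- A fixed vertex, as a vertex of the fixed subgraph. -/
def fixedVert (x : Γ.Vert) (hx : ∀ g ∈ P, Γ.actV x g = x) : (Γ.fixed P).Vert := ⟨x, hx⟩

/-- A fixed edge, as an edge of the fixed subgraph. -/
def fixedEdge (e : Γ.Edge) (he : ∀ g ∈ P, Γ.actE e g = e) : (Γ.fixed P).Edge := ⟨e, he⟩

/-- The fixed subgraph of a tree is connected. -/
theorem single_sub_single_mem_range [Nontrivial R] (hΓ : Γ.CochainsExact R)
    (hc : Γ.adjGraph.Preconnected) (x y : (Γ.fixed P).Vert) :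
    Finsupp.single y 1 - Finsupp.single x 1 ∈ LinearMap.range ((Γ.fixed P).boundary R) := by
  obtain ⟨q, hq⟩ := (hc x.1 y.1).exists_isPath
  have hfix : ∀ z ∈ q.support, ∀ g ∈ P, Γ.actV z g = z := fun z hz g hg =>
    map_support_of_isPath hΓ.isAcyclic q hq (x.2 g hg) (y.2 g hg) hz
  -- An edge is determined by its source and target, so it is fixed as soon as they are.
  have hedge : ∀ e : Γ.Edge, (∀ g ∈ P, Γ.actV (Γ.src e) g = Γ.src e) →
      (∀ g ∈ P, Γ.actV (Γ.tgt e) g = Γ.tgt e) → ∀ g ∈ P, Γ.actE e g = e := by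
    intro e hs ht g hg
    exact hΓ.eq_of_src_tgt ((Γ.src_act _ _).trans (hs g hg)) ((Γ.tgt_act _ _).trans (ht g hg))
  suffices H : ∀ (a b : Γ.Vert) (q : Γ.adjGraph.Walk a b)
      (hz : ∀ z ∈ q.support, ∀ g ∈ P, Γ.actV z g = z),
      (Finsupp.single (fixedVert b (hz b q.end_mem_support)) 1 -
        Finsupp.single (fixedVert a (hz a q.start_mem_support)) 1 : (Γ.fixed P).Vert →₀ R) ∈
          LinearMap.range ((Γ.fixed P).boundary R) from H _ _ q hfix
  intro a b q
  induction q with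
  | nil => intro hz; rw [sub_self]; exact zero_mem _
  | @cons a b c hab q ih =>
    intro hz
    have hb := hz b (by simp)
    have ha := hz a (by simp)
    have h1 := ih (fun z h => hz z (by simp [h]))
    rw [← sub_add_sub_cancel _ (Finsupp.single (fixedVert b hb) (1 : R))]
    refine add_mem h1 ?_
    rw [OrientedGraph.adjGraph_adj] at hab
    obtain ⟨-, ⟨e, rfl, rfl⟩ | ⟨e, rfl, rfl⟩⟩ := hab
    · exact ⟨Finsupp.single (fixedEdge e (hedge e ha hb)) 1,
        (OrientedGraph.boundary_single (Γ := Γ.fixed P) _ _).trans (one_smul R _)⟩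
    · rw [← neg_sub]
      exact neg_mem ⟨Finsupp.single (fixedEdge e (hedge e hb ha)) 1,
        (OrientedGraph.boundary_single (Γ := Γ.fixed P) _ _).trans (one_smul R _)⟩

end RightGraph

namespace GraphOfGroups

variable {V : Type u} {T : SimpleGraph V} (𝒢 : GraphOfGroups.{u, w} T)

theorem orbitGraph_cochainsExact (hT : T.IsTree) (R : Type*) [AddCommGroup R] :
    𝒢.orbitGraph.CochainsExact R :=
  fun f => 𝒢.exists_coboundary hT f

/-- The vertex `𝒢(v) g` of the orbit graph. -/
def coset (v : V) (g : 𝒢.Completion) : 𝒢.orbitGraph.Vert :=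
  ⟨v, (Quotient.mk _ g : RightCosets (𝒢.subgroup (Sum.inl v)))⟩

theorem coset_eq_iff {v : V} {g h : 𝒢.Completion} :
    𝒢.coset v g = 𝒢.coset v h ↔ h * g⁻¹ ∈ 𝒢.subgroup (Sum.inl v) := by
  rw [← QuotientGroup.rightRel_apply, coset, coset]
  constructor
  · intro hgh
    exact Quotient.exact (eq_of_heq (Sigma.mk.inj hgh).2)
  · intro hgh
    exact congrArg (Sigma.mk v) (Quotient.sound hgh)

@[simp]
theorem actV_coset (v : V) (g h : 𝒢.Completion) :
    𝒢.orbitGraph.actV (𝒢.coset v g) h = 𝒢.coset v (g * h) := rfl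

theorem exists_eq_coset (x : 𝒢.orbitGraph.Vert) : ∃ v g, x = 𝒢.coset v g := by
  obtain ⟨v, y⟩ := x
  induction y using Quotient.inductionOn with
  | h g => exact ⟨v, g, rfl⟩

/-- Cosets with the same representative are joined by a translate of a walk in `T`; the
representative can be changed because the vertex groups generate G. -/
theorem orbitGraph_preconnected (hT : T.IsTree) : 𝒢.orbitGraph.adjGraph.Preconnected := by
  have hv : ∀ v w g, 𝒢.orbitGraph.adjGraph.Reachable (𝒢.coset v g) (𝒢.coset w g) := by
    intro v w g
    obtain ⟨q⟩ := hT.connected v w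
    induction q with
    | nil => rfl
    | @cons v w _ h _ ih =>
      refine SimpleGraph.Reachable.trans ?_ ih
      let e : T.edgeSet := ⟨s(v, w), h⟩
      have hr : 𝒢.orbitGraph.adjGraph.Reachable (𝒢.coset (Quot.out e.1).1 g)
          (𝒢.coset (Quot.out e.1).2 g) :=
        𝒢.orbitGraph.reachable_src_tgt
          ⟨e, (Quotient.mk _ g : RightCosets (𝒢.subgroup (Sum.inr e)))⟩
      have ho : s((Quot.out e.1).1, (Quot.out e.1).2) = s(v, w) := Quot.out_eq e.1
      rw [Sym2.eq_iff] at ho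
      rcases ho with ⟨h1, h2⟩ | ⟨h1, h2⟩
      · rwa [h1, h2] at hr
      · rw [h1, h2] at hr
        exact hr.symm
  obtain ⟨v₀⟩ := hT.connected.nonempty
  have hg : ∀ g, 𝒢.orbitGraph.adjGraph.Reachable (𝒢.coset v₀ 1) (𝒢.coset v₀ g) := by
    intro g
    induction g using Completion.induction with
    | one => rfl
    | of v a =>
      refine (hv v₀ v 1).trans ?_
      rw [(𝒢.coset_eq_iff (g := 1) (h := 𝒢.ι (Sum.inl v) a)).mpr (by simp [subgroup])]
      exact hv _ _ _
    | mul a b ha hb =>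
      have := ha.map (𝒢.orbitGraph.adjHom b)
      refine hb.trans ?_
      change 𝒢.orbitGraph.adjGraph.Reachable (𝒢.coset v₀ (1 * b)) (𝒢.coset v₀ (a * b)) at this
      rwa [one_mul] at this
  intro x y
  obtain ⟨v, g, rfl⟩ := 𝒢.exists_eq_coset x
  obtain ⟨w, h, rfl⟩ := 𝒢.exists_eq_coset y
  exact (hv v v₀ g).trans ((hg g).symm.trans ((hg h).trans (hv v₀ w h)))

end GraphOfGroups

/-! ### `p`-subgroups of the vertex groups -/

/-- A `p`-subgroup of `K` is conjugate in `K` into every subgroup of `K` of index prime to `p`. -/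
theorem Subgroup.exists_conj_mem_of_not_dvd_relIndex {G : Type*} [Group G] {p : ℕ} [Fact p.Prime]
    {H K Q : Subgroup G} (hp : ¬ p ∣ H.relIndex K) (hQK : Q ≤ K) (hQ : IsPGroup p Q) :
    ∃ k : G, ∀ x ∈ Q, k * x * k⁻¹ ∈ H := by
  have hQ' : IsPGroup p (Q.subgroupOf K) := hQ.of_equiv (Subgroup.subgroupOfEquivOfLe hQK).symm
  -- Infinite index is recorded as 0, which p divides. On the finite quotient, Q has a fixed coset
  -- kH since its cardinality is prime to p.
  have hfin : Finite (K ⧸ H.subgroupOf K) := by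
    refine Nat.finite_of_card_ne_zero fun h => hp ?_
    rw [Subgroup.relIndex, Subgroup.index, h]
    exact dvd_zero p
  obtain ⟨y, hy⟩ := hQ'.nonempty_fixed_point_of_prime_not_dvd_card (K ⧸ H.subgroupOf K) hp
  obtain ⟨k, rfl⟩ := QuotientGroup.mk_surjective y
  refine ⟨(k : G)⁻¹, fun x hx => ?_⟩
  have h1 := hy ⟨⟨x, hQK hx⟩, Subgroup.mem_subgroupOf.mpr hx⟩
  have h2 : (QuotientGroup.mk ((⟨x, hQK hx⟩ : K) * k) : K ⧸ H.subgroupOf K) =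
    QuotientGroup.mk k := h1
  have h3 := Subgroup.mem_subgroupOf.mp (QuotientGroup.eq.mp h2.symm)
  simpa [mul_assoc] using h3

namespace GraphOfGroups

variable {V : Type u} {T : SimpleGraph V} {𝒢 : GraphOfGroups.{u, w} T} {p : ℕ}

/-- Passing to the image only enlarges H by the kernel of `ι`, so the relative index divides the
index of H. -/
theorem not_dvd_relIndex_map {v : V} {H : Subgroup (𝒢.obj (Sum.inl v))} (h : ¬ p ∣ H.index) :
    ¬ p ∣ (H.map (𝒢.ι (Sum.inl v))).relIndex (𝒢.subgroup (Sum.inl v)) := by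
  rw [subgroup, MonoidHom.range_eq_map, Subgroup.relIndex_map_map, top_sup_eq,
    Subgroup.relIndex_top_right]
  exact fun h' => h (h'.trans (Subgroup.index_dvd_of_le le_sup_left))

theorem subgroup_edge (e : T.edgeSet) (v : V) (h : v ∈ e.1) :
    𝒢.subgroup (Sum.inr e) = (𝒢.map e v h).range.map (𝒢.ι (Sum.inl v)) := by
  ext x
  simp [subgroup, ι_map]

/-- In a `p`-local tree of finite groups with centre `v₀`, every `p`-subgroup of a vertex group is
conjugate into a Sylow subgroup of the group at `v₀`. -/
theorem IsPLocal.exists_conj_mem [Fact p.Prime] {v₀ : V} (hloc : 𝒢.IsPLocal p v₀)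
    [Finite (𝒢.obj (Sum.inl v₀))] (S : Sylow p (𝒢.obj (Sum.inl v₀))) {v : V}
    (q : T.Walk v v₀) (hq : q.IsPath) {Q : Subgroup 𝒢.Completion} (hQ : IsPGroup p Q)
    (hQv : Q ≤ 𝒢.subgroup (Sum.inl v)) :
    ∃ g, ∀ x ∈ Q, g * x * g⁻¹ ∈
      (S : Subgroup (𝒢.obj (Sum.inl v₀))).map (𝒢.ι (Sum.inl v₀)) := by
  have hS : ¬ p ∣ (S : Subgroup (𝒢.obj (Sum.inl v₀))).index := S.not_dvd_index
  -- Only the index of the Sylow subgroup matters; forgetting the rest lets the end of the walk vary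
  -- in the induction.
  generalize (S : Subgroup (𝒢.obj (Sum.inl v₀))) = S at hS ⊢
  induction q generalizing Q with
  | nil =>
    exact Subgroup.exists_conj_mem_of_not_dvd_relIndex (not_dvd_relIndex_map hS) hQv hQ
  | @cons v w _ h q ih =>
    have h1 := not_dvd_relIndex_map (𝒢 := 𝒢) (hloc v w h ⟨q, hq⟩)
    rw [← subgroup_edge] at h1
    obtain ⟨k, hk⟩ := Subgroup.exists_conj_mem_of_not_dvd_relIndex h1 hQv hQ
    have hQ' : IsPGroup p (Q.map (MulAut.conj k).toMonoidHom) := hQ.map _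
    obtain ⟨g, hg⟩ := ih hloc ‹_› hq.of_cons hQ' (by
      rintro _ ⟨x, hx, rfl⟩
      exact 𝒢.subgroup_le _ _ (Sym2.mem_mk_right v w) (hk x hx)) _ hS
    refine ⟨g * k, fun x hx => ?_⟩
    have := hg _ ⟨x, hx, rfl⟩
    simpa [mul_assoc] using this

end GraphOfGroups

namespace FusionSystem

variable {G : Type*} [Group G] {S : Subgroup G}

/-- A conjugate contained in `S`, as an object of the fusion system. -/
def conj (P : FusionSystem S) (k : G) (hk : ∀ x ∈ P.carrier, k * x * k⁻¹ ∈ S) :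
    FusionSystem S where
  carrier := P.carrier.map (MulAut.conj k).toMonoidHom
  le := by
    rintro _ ⟨x, hx, rfl⟩
    exact hk x hx

/-- Conjugation as an isomorphism of groups onto a conjugate contained in `S`. -/
noncomputable def conjEquiv (P : FusionSystem S) (k : G) (hk : ∀ x ∈ P.carrier, k * x * k⁻¹ ∈ S) :
    P.carrier ≃* (P.conj k hk).carrier :=
  P.carrier.equivMapOfInjective (MulAut.conj k).toMonoidHom (MulAut.conj k).injective

theorem coe_conjEquiv (P : FusionSystem S) (k : G) (hk : ∀ x ∈ P.carrier, k * x * k⁻¹ ∈ S)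
    (x : P.carrier) : (P.conjEquiv k hk x : G) = k * x * k⁻¹ := rfl

/-- An object is isomorphic to its conjugates contained in `S`. -/
noncomputable def isoConj (P : FusionSystem S) (k : G) (hk : ∀ x ∈ P.carrier, k * x * k⁻¹ ∈ S) :
    P ≅ P.conj k hk where
  hom := ⟨(P.conjEquiv k hk).toMonoidHom, k⁻¹, fun x => by
    rw [inv_inv]
    exact P.coe_conjEquiv k hk x⟩
  inv := ⟨(P.conjEquiv k hk).symm.toMonoidHom, k, fun x => by
    obtain ⟨y, rfl⟩ := (P.conjEquiv k hk).surjective x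
    change (((P.conjEquiv k hk).symm (P.conjEquiv k hk y) : P.carrier) : G) = _
    rw [MulEquiv.symm_apply_apply, coe_conjEquiv]
    group⟩
  hom_inv_id := Subtype.ext (MonoidHom.ext fun x => (P.conjEquiv k hk).symm_apply_apply x)
  inv_hom_id := Subtype.ext (MonoidHom.ext fun x => (P.conjEquiv k hk).apply_symm_apply x)

/-- The conjugate of P by k is isomorphic to P in the fusion system, so centricity puts the
conjugate of d into its centre; conjugate back. -/
theorem IsCentric.mem_of_conj_mem {P : FusionSystem S} (hP : P.IsCentric) {k d : G}
    (hk : ∀ x ∈ P.carrier, k * x * k⁻¹ ∈ S) (hd : d ∈ Subgroup.centralizer (P.carrier : Set G))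
    (hkd : k * d * k⁻¹ ∈ S) : d ∈ P.carrier := by
  have h1 := hP _ ⟨P.isoConj k hk⟩
  have h2 : k * d * k⁻¹ ∈ Subgroup.centralizer ((P.conj k hk).carrier : Set G) ⊓ S := by
    refine ⟨Subgroup.mem_centralizer_iff.mpr ?_, hkd⟩
    rintro _ ⟨x, hx, rfl⟩
    have := Subgroup.mem_centralizer_iff.mp hd x hx
    simp only [MulEquiv.coe_toMonoidHom, MulAut.conj_apply]
    calc k * x * k⁻¹ * (k * d * k⁻¹) = k * (x * d) * k⁻¹ := by group
      _ = k * d * k⁻¹ * (k * x * k⁻¹) := by rw [this]; group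
  rw [h1] at h2
  obtain ⟨⟨_, x, hx, rfl⟩, -, h3⟩ := h2
  simp only [Subgroup.subtype_apply, MulEquiv.coe_toMonoidHom, MulAut.conj_apply,
    mul_left_inj, mul_right_inj] at h3
  exact h3 ▸ hx

end FusionSystem

theorem mem_centerInCentralizer {G : Type*} [Group G] {P : Subgroup G}
    {c : Subgroup.centralizer (P : Set G)} (hc : (c : G) ∈ P) : c ∈ centerInCentralizer P := by
  refine Subgroup.mem_subgroupOf.mpr ⟨⟨c, hc⟩, ?_, rfl⟩
  refine Subgroup.mem_center_iff.mpr fun g => Subtype.ext ?_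
  exact Subgroup.mem_centralizer_iff.mp c.2 g g.2

namespace GraphOfGroups

variable {V : Type u} {T : SimpleGraph V} {𝒢 : GraphOfGroups.{u, w} T} {p : ℕ}

theorem conj_mem_of_actV_coset {v : V} {g h : 𝒢.Completion}
    (hh : 𝒢.orbitGraph.actV (𝒢.coset v g) h = 𝒢.coset v g) :
    g * h * g⁻¹ ∈ 𝒢.subgroup (Sum.inl v) := by
  rw [actV_coset] at hh
  exact 𝒢.coset_eq_iff.mp hh.symm

/-- The stabilizers of vertices in `C_G(P) / Z(P)` have order prime to `p`. -/
theorem exists_pow_mem_centerInCentralizer (hT : T.IsTree) (hfin : ∀ X, Finite (𝒢.obj X))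
    [Fact p.Prime] {v₀ : V} (hloc : 𝒢.IsPLocal p v₀) (S : Sylow p (𝒢.obj (Sum.inl v₀)))
    {P : FusionSystem ((S : Subgroup (𝒢.obj (Sum.inl v₀))).map (𝒢.ι (Sum.inl v₀)))}
    (hP : P.IsCentric) (x : (𝒢.orbitGraph.fixed P.carrier).Vert)
    (c : Subgroup.centralizer (P.carrier : Set 𝒢.Completion))
    (hc : 𝒢.orbitGraph.actV x.1 c = x.1) :
    ∃ m, ¬ p ∣ m ∧ c ^ m ∈ centerInCentralizer P.carrier := by
  obtain ⟨x, hx⟩ := x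
  obtain ⟨v, g, rfl⟩ := 𝒢.exists_eq_coset x
  have hcK := conj_mem_of_actV_coset hc
  have hPK := fun y hy => conj_mem_of_actV_coset (hx y hy)
  have := hfin (Sum.inl v)
  have := hfin (Sum.inl v₀)
  have hKfin : Finite (𝒢.subgroup (Sum.inl v)) :=
    Finite.of_surjective _ (𝒢.ι (Sum.inl v)).rangeRestrict_surjective
  have hn : orderOf (c : 𝒢.Completion) ≠ 0 := by
    have h1 : orderOf (MulAut.conj g (c : 𝒢.Completion)) ≠ 0 :=
      (Submonoid.isOfFinOrder_coe.mpr (isOfFinOrder_of_finite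
        (⟨_, hcK⟩ : 𝒢.subgroup (Sum.inl v)))).orderOf_pos.ne'
    rwa [MulEquiv.orderOf_eq] at h1
  -- With m the prime-to-p part of the order of c, the power c^m has p-power order.
  obtain ⟨k, m, hm, hkm⟩ := Nat.exists_eq_pow_mul_and_not_dvd hn p (Fact.out : p.Prime).ne_one
  refine ⟨m, hm, mem_centerInCentralizer ?_⟩
  have hd : ((c : 𝒢.Completion) ^ m) ^ p ^ k = 1 := by
    rw [← pow_mul, mul_comm, ← hkm, pow_orderOf_eq_one]
  have hdc : (c : 𝒢.Completion) ^ m ∈ Subgroup.centralizer (P.carrier : Set 𝒢.Completion) :=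
    pow_mem c.2 m
  have hdp : IsPGroup p (Subgroup.zpowers ((c : 𝒢.Completion) ^ m)) := by
    rintro ⟨_, j, rfl⟩
    refine ⟨k, Subtype.ext ?_⟩
    change ((((c : 𝒢.Completion) ^ m) ^ j) ^ p ^ k) = 1
    rw [← zpow_natCast, zpow_comm, zpow_natCast, hd, one_zpow]
  have hPp : IsPGroup p P.carrier := (S.isPGroup'.map (𝒢.ι (Sum.inl v₀))).to_le P.le
  -- Since c^m centralizes P, it normalizes P, so the two generate a p-group. Moving both into S by
  -- one conjugation is what centricity requires.
  have hR := (hdp.to_sup_of_normal_right' hPp ((Subgroup.zpowers_le.mpr hdc).trans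
    (Subgroup.centralizer_le_normalizer _))).map (MulAut.conj g).toMonoidHom
  have hRK : (Subgroup.zpowers ((c : 𝒢.Completion) ^ m) ⊔ P.carrier).map
      (MulAut.conj g).toMonoidHom ≤ 𝒢.subgroup (Sum.inl v) := by
    rw [Subgroup.map_le_iff_le_comap, sup_le_iff, Subgroup.zpowers_le]
    refine ⟨?_, hPK⟩
    change MulAut.conj g ((c : 𝒢.Completion) ^ m) ∈ 𝒢.subgroup (Sum.inl v)
    rw [map_pow]
    exact pow_mem hcK m
  obtain ⟨q, hq⟩ := (hT.connected v v₀).exists_isPath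
  obtain ⟨h, hh⟩ := hloc.exists_conj_mem S q hq hR hRK
  have hh' : ∀ y ∈ Subgroup.zpowers ((c : 𝒢.Completion) ^ m) ⊔ P.carrier,
      (h * g) * y * (h * g)⁻¹ ∈
        (S : Subgroup (𝒢.obj (Sum.inl v₀))).map (𝒢.ι (Sum.inl v₀)) := by
    intro y hy
    have := hh _ ⟨y, hy, rfl⟩
    simpa [mul_assoc] using this
  exact hP.mem_of_conj_mem (fun y hy => hh' y (Subgroup.mem_sup_right hy)) hdc
    (hh' _ (Subgroup.mem_sup_left (Subgroup.mem_zpowers _)))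

end GraphOfGroups

/-! ### Homology of the quotient of a tree -/

open scoped TensorProduct

theorem OrientedGraph.boundary_mapDomain {R : Type*} [CommRing R] {Γ Δ : OrientedGraph.{u, w}}
    (fV : Γ.Vert → Δ.Vert) (fE : Γ.Edge → Δ.Edge) (hs : ∀ e, Δ.src (fE e) = fV (Γ.src e))
    (ht : ∀ e, Δ.tgt (fE e) = fV (Γ.tgt e)) (y : Γ.Edge →₀ R) :
    Δ.boundary R (y.mapDomain fE) = (Γ.boundary R y).mapDomain fV := by
  induction y using Finsupp.induction_linear with
  | zero => simp
  | add a b ha hb => simp [Finsupp.mapDomain_add, ha, hb]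
  | single e r =>
    rw [Finsupp.mapDomain_single, boundary_single, boundary_single, Finsupp.mapDomain_smul,
      ← Finsupp.mapDomain.addMonoidHom_apply fV, map_sub]
    simp [hs, ht, Finsupp.mapDomain_single]

/-- Chains with the same image under a surjection differ by differences of equivalent points. -/
theorem Finsupp.mem_span_of_mapDomain_eq_zero {R X : Type*} [CommRing R] (s : Setoid X)
    {y : X →₀ R} (hy : y.mapDomain (Quotient.mk s) = 0) :
    y ∈ Submodule.span R {z | ∃ a b, s a b ∧ z = Finsupp.single b 1 - Finsupp.single a 1} := by
  have main : ∀ y : X →₀ R, y - (y.mapDomain (Quotient.mk s)).mapDomain Quotient.out ∈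
      Submodule.span R {z | ∃ a b, s a b ∧ z = Finsupp.single b 1 - Finsupp.single a 1} := by
    intro y
    induction y using Finsupp.induction_linear with
    | zero => simp
    | add a b ha hb =>
      rw [Finsupp.mapDomain_add, Finsupp.mapDomain_add, add_sub_add_comm]
      exact add_mem ha hb
    | single x r =>
      rw [Finsupp.mapDomain_single, Finsupp.mapDomain_single]
      have : (Finsupp.single x r - Finsupp.single (Quotient.mk s x).out r : X →₀ R) =
          r • (Finsupp.single x 1 - Finsupp.single (Quotient.mk s x).out 1) := by
        simp [smul_sub]
      rw [this]
      exact Submodule.smul_mem _ _ (Submodule.subset_span ⟨_, _, Quotient.mk_out x, rfl⟩)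
  have := main y
  rwa [hy, Finsupp.mapDomain_zero, sub_zero] at this

namespace RightGraph

variable {G : Type*} [Group G] {Γ : RightGraph.{u, w} G} {P : Subgroup G}

/-- The action of the centralizer on the vertices of the fixed subgraph. -/
def fixedActV (c : Subgroup.centralizer (P : Set G)) (x : (Γ.fixed P).Vert) :
    (Γ.fixed P).Vert :=
  ⟨Γ.actV x.1 c, fun g hg => by
    rw [← Γ.actV_mul, ← Subgroup.mem_centralizer_iff.mp c.2 g hg, Γ.actV_mul, x.2 g hg]⟩

/-- The action of the centralizer on the edges of the fixed subgraph. -/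
def fixedActE (c : Subgroup.centralizer (P : Set G)) (x : (Γ.fixed P).Edge) :
    (Γ.fixed P).Edge :=
  ⟨Γ.actE x.1 c, fun g hg => by
    rw [← Γ.actE_mul, ← Subgroup.mem_centralizer_iff.mp c.2 g hg, Γ.actE_mul, x.2 g hg]⟩

theorem fixedActV_mul (c d : Subgroup.centralizer (P : Set G)) (x : (Γ.fixed P).Vert) :
    fixedActV (c * d) x = fixedActV d (fixedActV c x) :=
  Subtype.ext (Γ.actV_mul _ _ _)

theorem fixedActV_inv (c : Subgroup.centralizer (P : Set G)) (x : (Γ.fixed P).Vert) :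
    fixedActV c⁻¹ (fixedActV c x) = x := by
  rw [← fixedActV_mul, mul_inv_cancel]
  exact Subtype.ext (Γ.actV_one _)

theorem src_fixedActE (c : Subgroup.centralizer (P : Set G)) (e : (Γ.fixed P).Edge) :
    (Γ.fixed P).src (fixedActE c e) = fixedActV c ((Γ.fixed P).src e) :=
  Subtype.ext (Γ.src_act _ _)

theorem tgt_fixedActE (c : Subgroup.centralizer (P : Set G)) (e : (Γ.fixed P).Edge) :
    (Γ.fixed P).tgt (fixedActE c e) = fixedActV c ((Γ.fixed P).tgt e) :=
  Subtype.ext (Γ.tgt_act _ _)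

/-- The projection of the fixed subgraph to its quotient, on vertices. -/
def projV (x : (Γ.fixed P).Vert) : (Γ.fixedQuotient P).Vert := Quotient.mk (Γ.vertSetoid P) x

/-- The projection of the fixed subgraph to its quotient, on edges. -/
def projE (x : (Γ.fixed P).Edge) : (Γ.fixedQuotient P).Edge := Quotient.mk (Γ.edgeSetoid P) x

theorem projE_surjective : Function.Surjective (projE (Γ := Γ) (P := P)) :=
  Quotient.mk_surjective

theorem projV_eq_iff {x y : (Γ.fixed P).Vert} :
    projV x = projV y ↔ ∃ c : Subgroup.centralizer (P : Set G), fixedActV c x = y := by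
  constructor
  · intro h
    obtain ⟨c, hc, h⟩ := Quotient.exact h
    exact ⟨⟨c, hc⟩, Subtype.ext h⟩
  · rintro ⟨c, h⟩
    exact Quotient.sound ⟨c, c.2, congrArg Subtype.val h⟩

@[simp]
theorem projV_fixedActV (c : Subgroup.centralizer (P : Set G)) (x : (Γ.fixed P).Vert) :
    projV (fixedActV c x) = projV x :=
  (projV_eq_iff.mpr ⟨c, rfl⟩).symm

@[simp]
theorem projE_fixedActE (c : Subgroup.centralizer (P : Set G)) (x : (Γ.fixed P).Edge) :
    projE (fixedActE c x) = projE x :=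
  (Quotient.sound ⟨c, c.2, rfl⟩ : projE x = projE (fixedActE c x)).symm

/-- A homomorphism on the centralizer that vanishes on the stabilizers of the vertices of the fixed
subgraph is the difference along orbits of a function on vertices. -/
theorem exists_equivariant {A : Type*} [AddCommGroup A]
    (α : Subgroup.centralizer (P : Set G) →* Multiplicative A)
    (hα : ∀ (x : (Γ.fixed P).Vert) (c : Subgroup.centralizer (P : Set G)),
      fixedActV c x = x → α c = 1) :
    ∃ β : (Γ.fixed P).Vert → A, ∀ x c, β (fixedActV c x) = β x + (α c).toAdd := by
  have hr : ∀ x : (Γ.fixed P).Vert, ∃ c : Subgroup.centralizer (P : Set G),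
      fixedActV c (Quotient.out (projV x)) = x := fun x =>
    projV_eq_iff.mp (Quotient.out_eq (projV x))
  choose r hr using hr
  refine ⟨fun x => (α (r x)).toAdd, fun x c => ?_⟩
  have h1 := hr (fixedActV c x)
  rw [projV_fixedActV] at h1
  -- Going from the orbit representative to x, then by c, then back is a stabilizing element, on
  -- which α vanishes.
  have h2 : fixedActV (r x * c * (r (fixedActV c x))⁻¹) (Quotient.out (projV x)) =
      Quotient.out (projV x) := by
    rw [fixedActV_mul, fixedActV_mul, hr x]
    exact (congrArg _ h1.symm).trans (fixedActV_inv _ _)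
  have h3 := hα _ _ h2
  rw [map_mul, map_inv, mul_inv_eq_one, map_mul] at h3
  change (α (r (fixedActV c x))).toAdd = _
  rw [← h3]
  rfl

theorem boundary_projE {R : Type*} [CommRing R] (y : (Γ.fixed P).Edge →₀ R) :
    (Γ.fixedQuotient P).boundary R (y.mapDomain projE) =
      ((Γ.fixed P).boundary R y).mapDomain projV :=
  OrientedGraph.boundary_mapDomain (Γ := Γ.fixed P) (Δ := Γ.fixedQuotient P) projV projE
    (fun _ => rfl) (fun _ => rfl) y

theorem boundary_fixedActE {R : Type*} [CommRing R] (c : Subgroup.centralizer (P : Set G))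
    (y : (Γ.fixed P).Edge →₀ R) :
    (Γ.fixed P).boundary R (y.mapDomain (fixedActE c)) =
      ((Γ.fixed P).boundary R y).mapDomain (fixedActV c) :=
  OrientedGraph.boundary_mapDomain _ _ (src_fixedActE c) (tgt_fixedActE c) y

theorem mapDomain_projE_fixedActE {R : Type*} [CommRing R]
    (c : Subgroup.centralizer (P : Set G)) (y : (Γ.fixed P).Edge →₀ R) :
    (y.mapDomain (fixedActE c)).mapDomain projE = y.mapDomain projE := by
  rw [← Finsupp.mapDomain_comp]
  congr 1
  ext x
  exact projE_fixedActE c x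

variable {R : Type*} [CommRing R]

/-- The chain `y` bounds the difference between the translate of `x₀` by `c` and `x₀`. -/
def IsChainTo (x₀ : (Γ.fixed P).Vert) (c : Subgroup.centralizer (P : Set G))
    (y : (Γ.fixed P).Edge →₀ R) : Prop :=
  (Γ.fixed P).boundary R y = Finsupp.single (fixedActV c x₀) 1 - Finsupp.single x₀ 1

theorem IsChainTo.boundary_projE_eq_zero {x₀ : (Γ.fixed P).Vert}
    {c : Subgroup.centralizer (P : Set G)} {y : (Γ.fixed P).Edge →₀ R} (h : IsChainTo x₀ c y) :
    (Γ.fixedQuotient P).boundary R (y.mapDomain projE) = 0 := by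
  rw [boundary_projE, h, Finsupp.mapDomain_sub, Finsupp.mapDomain_single,
    Finsupp.mapDomain_single, projV_fixedActV, sub_self]

/-- The homomorphism sending an element of the centralizer to the cycle in the quotient that is the
image of a path to the translate of the base point. -/
theorem exists_cycleHom [Nontrivial R] (hΓ : Γ.CochainsExact R) (hc : Γ.adjGraph.Preconnected)
    (x₀ : (Γ.fixed P).Vert) :
    ∃ φ : Subgroup.centralizer (P : Set G) →* Multiplicative ((Γ.fixedQuotient P).H1 R),
      ∀ c, ∃ y, IsChainTo x₀ c y ∧ (φ c).toAdd.1 = y.mapDomain projE := by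
  have hinj := (fixed_cochainsExact hΓ P).boundary_injective
  have hconn : ∀ c : Subgroup.centralizer (P : Set G),
      ∃ y : (Γ.fixed P).Edge →₀ R, IsChainTo x₀ c y := fun c =>
    single_sub_single_mem_range hΓ hc (P := P) x₀ (fixedActV c x₀)
  choose b hb using hconn
  -- The path from x₀ to x₀d followed by the d-translate of the path from x₀ to x₀c ends at x₀cd;
  -- chains are determined by their boundary.
  have hbmul : ∀ c d, b (c * d) = (b c).mapDomain (fixedActE d) + b d := by
    intro c d
    apply hinj
    rw [map_add, boundary_fixedActE, hb, hb, hb, Finsupp.mapDomain_sub, Finsupp.mapDomain_single,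
      Finsupp.mapDomain_single, fixedActV_mul, sub_add_sub_cancel]
  refine ⟨MonoidHom.mk' (fun c => Multiplicative.ofAdd
    (⟨(b c).mapDomain projE, (hb c).boundary_projE_eq_zero⟩ : (Γ.fixedQuotient P).H1 R)) ?_,
    fun c => ⟨b c, hb c, rfl⟩⟩
  intro c d
  rw [← ofAdd_add]
  refine congrArg Multiplicative.ofAdd (Subtype.ext ?_)
  change (b (c * d)).mapDomain projE = (b c).mapDomain projE + (b d).mapDomain projE
  rw [hbmul, Finsupp.mapDomain_add, mapDomain_projE_fixedActE]

/-- The homology of the quotient is spanned by images of paths between translates of the base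
point. -/
theorem mem_of_isChainTo [Nontrivial R] (hΓ : Γ.CochainsExact R) (hc : Γ.adjGraph.Preconnected)
    (x₀ : (Γ.fixed P).Vert) (K : Submodule R ((Γ.fixedQuotient P).Edge →₀ R))
    (hK : ∀ c, ∃ y, IsChainTo x₀ c y ∧ y.mapDomain projE ∈ K)
    {z : (Γ.fixedQuotient P).Edge →₀ R} (hz : (Γ.fixedQuotient P).boundary R z = 0) : z ∈ K := by
  have hinj := (fixed_cochainsExact hΓ P).boundary_injective
  have hconn := fun x => single_sub_single_mem_range hΓ hc (P := P) x₀ x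
  choose y hy using hconn
  obtain ⟨w, rfl⟩ := Finsupp.mapDomain_surjective (M := R) (projE_surjective (Γ := Γ) (P := P)) z
  rw [boundary_projE] at hz
  have hspan := Finsupp.mem_span_of_mapDomain_eq_zero (Γ.vertSetoid P) hz
  -- For x' = xc, the chain from x back to x₀, on to x₀c, then along the c-translate to xc bounds x'
  -- - x. Its outer pieces cancel in the quotient, leaving the image of the middle one, which lies
  -- in K.
  have hle : Submodule.span R {z | ∃ a b, Γ.vertSetoid P a b ∧
      z = Finsupp.single b (1 : R) - Finsupp.single a 1} ≤
        (K.comap (Finsupp.lmapDomain R R (projE (Γ := Γ) (P := P)))).map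
          ((Γ.fixed P).boundary R) := by
    rw [Submodule.span_le]
    rintro _ ⟨x, x', hxx, rfl⟩
    obtain ⟨c, rfl⟩ := projV_eq_iff.mp (Quotient.sound hxx : projV x = projV x')
    obtain ⟨b, hb, hbK⟩ := hK c
    refine ⟨(y x).mapDomain (fixedActE c) - y x + b, ?_, ?_⟩
    · change Finsupp.mapDomain projE _ ∈ K
      rwa [Finsupp.mapDomain_add, Finsupp.mapDomain_sub, mapDomain_projE_fixedActE, sub_self,
        zero_add]
    · rw [map_add, map_sub, boundary_fixedActE, hy, hb, Finsupp.mapDomain_sub,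
        Finsupp.mapDomain_single, Finsupp.mapDomain_single]
      abel
  obtain ⟨w', hw'K, hw'⟩ := hle hspan
  obtain rfl := hinj hw'
  exact hw'K

/-- A homomorphism on the centralizer that vanishes on the vertex stabilizers factors through the
homology of the quotient. -/
theorem exists_linearMap_H1 {A : Type*} [AddCommGroup A] [Module R A] (x₀ : (Γ.fixed P).Vert)
    (α : Subgroup.centralizer (P : Set G) →* Multiplicative A)
    (hα : ∀ (x : (Γ.fixed P).Vert) (c : Subgroup.centralizer (P : Set G)),
      fixedActV c x = x → α c = 1) :
    ∃ Ψ : (Γ.fixedQuotient P).H1 R →ₗ[R] A, ∀ (z : (Γ.fixedQuotient P).H1 R) c y,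
      IsChainTo x₀ c y → z.1 = y.mapDomain projE → Ψ z = (α c).toAdd := by
  obtain ⟨β, hβ⟩ := exists_equivariant α hα
  -- Translation by c shifts β by a constant on each orbit, the same for all orbits, so its
  -- coboundary descends to the quotient graph.
  let δ : (Γ.fixed P).Edge → A := fun e => β ((Γ.fixed P).tgt e) - β ((Γ.fixed P).src e)
  have hδ : ∀ e e' : (Γ.fixed P).Edge, (Γ.edgeSetoid P) e e' → δ e = δ e' := by
    rintro e e' ⟨c, hc, h⟩
    obtain rfl : fixedActE ⟨c, hc⟩ e = e' := Subtype.ext h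
    simp only [δ, src_fixedActE, tgt_fixedActE, hβ, add_sub_add_right_eq_sub]
  let δ' : (Γ.fixedQuotient P).Edge → A := Quotient.lift (s := Γ.edgeSetoid P) δ hδ
  refine ⟨(Finsupp.linearCombination R δ').comp (Submodule.subtype _), fun z c y hy hz => ?_⟩
  rw [LinearMap.comp_apply, Submodule.subtype_apply, hz, Finsupp.linearCombination_mapDomain]
  refine (OrientedGraph.CochainsExact.boundary_pairing (Γ := Γ.fixed P) (f := δ' ∘ projE)
    (h := β) (fun _ => rfl) y).symm.trans ?_
  rw [hy, map_sub, Finsupp.linearCombination_single,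
    Finsupp.linearCombination_single, one_smul, one_smul, hβ, add_sub_cancel_left]

end RightGraph

/-- A module generated by the image of a group `C`, and onto which the tautological map to
`R ⊗ Ab (C / N)` extends, is isomorphic to `R ⊗ Ab (C / N)`. -/
theorem nonempty_linearEquiv_tensor_abelianization {R C H : Type*} [CommRing R] [Group C]
    (N : Subgroup C) [N.Normal] [AddCommGroup H] [Module R H] (φ : C →* Multiplicative H)
    (hN : N ≤ φ.ker) (hspan : ∀ K : Submodule R H, (∀ c, (φ c).toAdd ∈ K) → K = ⊤)
    (Ψ : H →ₗ[R] R ⊗[ℤ] Additive (Abelianization (C ⧸ N)))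
    (hΨ : ∀ c, Ψ (φ c).toAdd =
      1 ⊗ₜ[ℤ] Additive.ofMul (Abelianization.of (QuotientGroup.mk c : C ⧸ N))) :
    Nonempty (H ≃ₗ[R] R ⊗[ℤ] Additive (Abelianization (C ⧸ N))) := by
  let φ' : Additive (Abelianization (C ⧸ N)) →+ H :=
    MonoidHom.toAdditiveLeft (Abelianization.lift (QuotientGroup.lift N φ hN))
  let Φ := LinearMap.liftBaseChange R φ'.toIntLinearMap
  have hΦ : ∀ c : C, Φ ((1 : R) ⊗ₜ[ℤ] Additive.ofMul
      (Abelianization.of (QuotientGroup.mk c : C ⧸ N))) = (φ c).toAdd := by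
    intro c
    rw [LinearMap.liftBaseChange_tmul, one_smul]
    rfl
  have hΨΦ : ∀ t, Ψ (Φ t) = t := by
    intro t
    induction t using TensorProduct.induction_on with
    | zero => simp
    | add s t hs ht => rw [map_add, map_add, hs, ht]
    | tmul r m =>
      obtain ⟨a, rfl⟩ := Additive.ofMul.surjective m
      obtain ⟨a, rfl⟩ := QuotientGroup.mk_surjective a
      obtain ⟨c, rfl⟩ := QuotientGroup.mk_surjective a
      have h1 : ∀ m : Additive (Abelianization (C ⧸ N)),
          r ⊗ₜ[ℤ] m = r • ((1 : R) ⊗ₜ[ℤ] m) := by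
        intro m
        rw [TensorProduct.smul_tmul', smul_eq_mul, mul_one]
      rw [h1, map_smul, map_smul]
      exact congrArg (r • ·) ((congrArg Ψ (hΦ c)).trans (hΨ c))
  have hsurj : Function.Surjective Φ :=
    LinearMap.range_eq_top.mp (hspan _ fun c => ⟨_, hΦ c⟩)
  exact ⟨(LinearEquiv.ofBijective Φ ⟨Function.LeftInverse.injective hΨΦ, hsurj⟩).symm⟩

namespace RightGraph

variable {G : Type*} [Group G] {Γ : RightGraph.{u, w} G} {P : Subgroup G}

/-- If `Γ` is a tree, the homology of `Γ^P / C_G(P)` is the abelianization, with coefficients in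
`R`, of the quotient of `C_G(P)` by a normal subgroup fixing a vertex, provided that all the vertex
stabilizers die in it. -/
theorem nonempty_H1_fixedQuotient_equiv {R : Type*} [CommRing R] [Nontrivial R]
    (hΓ : Γ.CochainsExact R) (hc : Γ.adjGraph.Preconnected) (x₀ : (Γ.fixed P).Vert)
    (N : Subgroup (Subgroup.centralizer (P : Set G))) [N.Normal]
    (hN : ∀ c ∈ N, fixedActV c x₀ = x₀)
    (hstab : ∀ (x : (Γ.fixed P).Vert) (c : Subgroup.centralizer (P : Set G)),
      fixedActV c x = x → (1 : R) ⊗ₜ[ℤ] Additive.ofMul (Abelianization.of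
        (QuotientGroup.mk c : Subgroup.centralizer (P : Set G) ⧸ N)) = 0) :
    Nonempty ((Γ.fixedQuotient P).H1 R ≃ₗ[R]
      R ⊗[ℤ] Additive (Abelianization (Subgroup.centralizer (P : Set G) ⧸ N))) := by
  obtain ⟨φ, hφ⟩ := exists_cycleHom hΓ hc x₀
  let α : Subgroup.centralizer (P : Set G) →* Multiplicative
      (R ⊗[ℤ] Additive (Abelianization (Subgroup.centralizer (P : Set G) ⧸ N))) :=
    MonoidHom.mk' (fun c => Multiplicative.ofAdd ((1 : R) ⊗ₜ[ℤ] Additive.ofMul (Abelianization.of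
      (QuotientGroup.mk c : Subgroup.centralizer (P : Set G) ⧸ N)))) (by
        intro c d
        rw [QuotientGroup.mk_mul, map_mul, ofMul_mul, TensorProduct.tmul_add, ofAdd_add])
  obtain ⟨Ψ, hΨ⟩ := exists_linearMap_H1 (Γ := Γ) (R := R) x₀ α hstab
  refine nonempty_linearEquiv_tensor_abelianization N φ ?_ ?_ Ψ ?_
  · intro c hcN
    obtain ⟨y, hy, hφc⟩ := hφ c
    have h0 : y = 0 := by
      apply (fixed_cochainsExact hΓ P).boundary_injective
      rw [hy, hN c hcN, sub_self, map_zero]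
    rw [h0, Finsupp.mapDomain_zero] at hφc
    exact MonoidHom.mem_ker.mpr (congrArg Multiplicative.ofAdd (Subtype.ext hφc))
  · intro K hK
    rw [eq_top_iff]
    rintro ⟨z, hz⟩ -
    obtain ⟨z', hz', h⟩ := mem_of_isChainTo hΓ hc x₀ (K.map (Submodule.subtype _)) (fun c => by
      obtain ⟨y, hy, hφc⟩ := hφ c
      exact ⟨y, hy, _, hK c, hφc⟩) hz
    obtain rfl : z' = ⟨z, hz⟩ := Subtype.ext h
    exact hz'
  · intro c
    obtain ⟨y, hy, hφc⟩ := hφ c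
    exact hΨ _ c y hy hφc

end RightGraph

theorem mainTheorem5 {V : Type u} {T : SimpleGraph V} (hT : T.IsTree)
    (𝒢 : GraphOfGroups.{u, w} T) (hfin : ∀ X, Finite (𝒢.obj X))
    (p : ℕ) [Fact p.Prime] (v₀ : V) (hloc : 𝒢.IsPLocal p v₀)
    (S : Sylow p (𝒢.obj (Sum.inl v₀)))
    (P : FusionSystem ((S : Subgroup (𝒢.obj (Sum.inl v₀))).map (𝒢.ι (Sum.inl v₀))))
    (hP : P.IsCentric) :
    Nonempty (𝒢.CGp p P.carrier ≃ₗ[ZMod p]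
      TensorProduct ℤ (ZMod p)
        (Additive (Abelianization
          (Subgroup.centralizer (P.carrier : Set 𝒢.Completion) ⧸
            centerInCentralizer P.carrier)))) := by
  have hx₀ : ∀ g ∈ P.carrier, 𝒢.orbitGraph.actV (𝒢.coset v₀ 1) g = 𝒢.coset v₀ 1 := by
    intro g hg
    obtain ⟨s, -, hs⟩ := P.le hg
    rw [GraphOfGroups.actV_coset, eq_comm, GraphOfGroups.coset_eq_iff]
    exact ⟨s, by simpa using hs⟩
  refine RightGraph.nonempty_H1_fixedQuotient_equiv (𝒢.orbitGraph_cochainsExact hT (ZMod p))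
    (𝒢.orbitGraph_preconnected hT) (RightGraph.fixedVert _ hx₀) _ ?_ ?_
  · intro c hc
    obtain ⟨z, -, hz⟩ := Subgroup.mem_subgroupOf.mp hc
    refine Subtype.ext (hx₀ c ?_)
    rw [← hz]
    exact z.2
  · intro x c hcx
    obtain ⟨m, hm, hcm⟩ := GraphOfGroups.exists_pow_mem_centerInCentralizer hT hfin hloc S hP x c
      (congrArg Subtype.val hcx)
    -- The class of c is killed by m, which is invertible in 𝔽_p.
    have hm' : (m : ZMod p) ≠ 0 := by rwa [Ne, ZMod.natCast_eq_zero_iff]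
    have h1 : m • ((1 : ZMod p) ⊗ₜ[ℤ] Additive.ofMul (Abelianization.of
        (QuotientGroup.mk c : Subgroup.centralizer (P.carrier : Set 𝒢.Completion) ⧸
          centerInCentralizer P.carrier))) = 0 := by
      rw [← TensorProduct.tmul_smul, ← ofMul_pow, ← map_pow, ← QuotientGroup.mk_pow,
        (QuotientGroup.eq_one_iff _).mpr hcm, map_one, ofMul_one, TensorProduct.tmul_zero]
    rw [← Nat.cast_smul_eq_nsmul (ZMod p)] at h1
    exact (smul_eq_zero.mp h1).resolve_left hm'
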